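/- Let $m \ge 0$ and let $L_1,\dots,L_m \in M_2(\mathbb{C})$ be arbitrary matrices (jump operators; they need not be traceless). Let $$\mathcal{D}(X) = \sum_{j=1}^m \Big( L_j X L_j^\dagger - \tfrac12\big(L_j^\dagger L_j X + X L_j^\dagger L_j\big) \Big)$$ be the associated dissipator on $M_2(\mathbb{C})$. For a time-dependent linear map $\mathcal{L}_t$ on $M_2(\mathbb{C})$ with locally integrable entries, let $\mathcal{E}_{t,s} = \mathcal{T}\exp\big(\int_s^t \mathcal{L}_\tau\, d\tau\big)$ be the time-ordered exponential (the Dyson series), i.e. the evolution from time $s$ to time $t$ of $\dot X = \mathcal{L}_t X$. Call $\mathcal{L}_t$ *exponentially contractive* if there are $K,\gamma>0$ such that $$\|\mathcal{E}_{t,s}(\rho-\sigma)\|_1 \le K e^{-\gamma|t-s|}\,\|\rho-\sigma\|_1$$ for all states $\rho,\sigma$ (positive semidefinite matrices of trace $1$) and all $t\ge s\ge 0$, where $\|\cdot\|_1$ is the trace norm. Call $\mathcal{D}$ *Hamiltonian-independently contractive* if for every family $H(t)$, $t \in \mathbb{R}$, of Hermitian matrices with locally integrable entries the Lindbladian $\mathcal{L}_t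 = -i[H(t),\,\cdot\,]+\mathcal{D}$ is exponentially contractive (the constants $K,\gamma$ may depend on $H$). Then the following are equivalent: 1. $\mathcal{D}$ is Hamiltonian-independently contractive. 2. The time-independent Lindbladian $\mathcal{L} = \mathcal{D}$ is exponentially contractive. 3. The set $\{L_j, L_j^\dagger\}_j$ generates the full matrix algebra $M_2(\mathbb{C})$ as a complex algebra. 4. At least one $L_j$ is not normal, or there are $j,k$ such that $L_j$ and $L_k$ do not commute. -/

import Mathlib

open MeasureTheory
open scoped Matrix ComplexOrder

namespace Lindblad

noncomputable section

/-- The dissipator `X ↦ L X L† - (L†L X + X L†L) / 2` of a single jump operator `L`,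
as a linear map on `d × d` complex matrices. -/
def jumpDissipator {d : ℕ} (L : Matrix (Fin d) (Fin d) ℂ) :
    Module.End ℂ (Matrix (Fin d) (Fin d) ℂ) where
  toFun X := L * X * Lᴴ - (1 / 2 : ℂ) • (Lᴴ * L * X + X * (Lᴴ * L))
  map_add' X Y := by
    simp only [mul_add, add_mul, smul_add]
    abel
  map_smul' c X := by
    simp only [Matrix.mul_smul, Matrix.smul_mul, RingHom.id_apply, smul_sub, smul_add,
      smul_comm c (1 / 2 : ℂ)]

/-- The dissipator `𝒟 = ∑ j, 𝒟_{L j}` of a finite family of jump operators. -/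
def dissipator {d m : ℕ} (L : Fin m → Matrix (Fin d) (Fin d) ℂ) :
    Module.End ℂ (Matrix (Fin d) (Fin d) ℂ) :=
  ∑ j, jumpDissipator (L j)

/-- The Hamiltonian part `X ↦ -i [H, X]` of a Lindbladian. -/
def hamiltonianPart {d : ℕ} (H : Matrix (Fin d) (Fin d) ℂ) :
    Module.End ℂ (Matrix (Fin d) (Fin d) ℂ) where
  toFun X := (-Complex.I) • (H * X - X * H)
  map_add' X Y := by
    rw [← smul_add, mul_add, add_mul, add_sub_add_comm]
  map_smul' c X := by
    simp only [Matrix.mul_smul, Matrix.smul_mul, RingHom.id_apply, ← smul_sub]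
    rw [smul_comm]

/-- The terms of the Dyson series with starting time `s` and starting matrix `X`: the `n`-th term
at time `t` is the iterated integral of `𝓛_{τ₁} (𝓛_{τ₂} (⋯ (𝓛_{τₙ} X)))` over
`t ≥ τ₁ ≥ τ₂ ≥ ⋯ ≥ τₙ ≥ s`. Integrals of matrices are taken entrywise. -/
def dysonTerm {d : ℕ} (𝓛 : ℝ → Module.End ℂ (Matrix (Fin d) (Fin d) ℂ)) (s : ℝ)
    (X : Matrix (Fin d) (Fin d) ℂ) : ℕ → ℝ → Matrix (Fin d) (Fin d) ℂ
  | 0, _ => X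
  | n + 1, t => Matrix.of fun i j => ∫ τ in s..t, 𝓛 τ (dysonTerm 𝓛 s X n τ) i j

/-- The time-evolution channel `ℰ_{t,s} = 𝒯 exp (∫_s^t 𝓛_τ dτ)` (time-ordered exponential, given
by the Dyson series), applied to the matrix `X`. -/
def evolution {d : ℕ} (𝓛 : ℝ → Module.End ℂ (Matrix (Fin d) (Fin d) ℂ)) (t s : ℝ)
    (X : Matrix (Fin d) (Fin d) ℂ) : Matrix (Fin d) (Fin d) ℂ :=
  ∑' n, dysonTerm 𝓛 s X n t

/-- The trace norm (Schatten 1-norm): the sum of the singular values, i.e. of the square roots of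
the eigenvalues of `A† A`. -/
def traceNorm {d : ℕ} (A : Matrix (Fin d) (Fin d) ℂ) : ℝ :=
  ∑ i, √((Matrix.isHermitian_conjTranspose_mul_self A).eigenvalues i)

/-- Quantum states: positive semidefinite matrices of trace one. -/
def IsState {d : ℕ} (ρ : Matrix (Fin d) (Fin d) ℂ) : Prop :=
  ρ.PosSemidef ∧ ρ.trace = 1

/-- Exponential contractivity of a time-dependent Lindbladian. -/
def IsExpContractive {d : ℕ} (𝓛 : ℝ → Module.End ℂ (Matrix (Fin d) (Fin d) ℂ)) : Prop :=
  ∃ K γ : ℝ, 0 < K ∧ 0 < γ ∧ ∀ ρ σ : Matrix (Fin d) (Fin d) ℂ, IsState ρ → IsState σ →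
    ∀ s t : ℝ, 0 ≤ s → s ≤ t →
      traceNorm (evolution 𝓛 t s (ρ - σ)) ≤ K * Real.exp (-γ * |t - s|) * traceNorm (ρ - σ)

/-- `𝒟` is Hamiltonian-independently contractive: for every Hermitian `H(t)` with locally
integrable entries, `-i [H(t), ·] + 𝒟` is exponentially contractive. -/
def IsHamiltonianIndependentlyContractive {d : ℕ}
    (𝓓 : Module.End ℂ (Matrix (Fin d) (Fin d) ℂ)) : Prop :=
  ∀ H : ℝ → Matrix (Fin d) (Fin d) ℂ, (∀ t, (H t).IsHermitian) →
    (∀ i j, LocallyIntegrable (fun t => H t i j) volume) →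
      IsExpContractive fun t => hamiltonianPart (H t) + 𝓓

end

end Lindblad

/-! A difference of two qubit states is a traceless Hermitian matrix `X`, and then `X * X` is the
scalar `r ^ 2`, with `r` the Euclidean length of the Bloch vector. Hence the trace norm is `2 * r`,
and contraction can be read off from the derivative of `r ^ 2`.

The Hamiltonian part is orthogonal to `X`, since tr(X[H, X]) = 0. Since `X * X` is scalar, the
dissipator satisfies tr(X 𝓓(X)) = -(1/2) ∑ ‖[X, L j]‖² in the Hilbert–Schmidt norm
(`blochCoord_dot_jumpDissipator`). Under condition 4 no nonzero traceless Hermitian `X` commutes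
with every `L j`, because the centralizer of such an `X` is commutative
(`commute_of_commute_traceless`). Compactness turns this into a rate γ independent of `H`
(`exists_dissipation_rate`), and a Grönwall argument along the Dyson series gives condition 1 with
`K = 1`. Condition 2 is the case `H = 0`.

If condition 4 fails, Fuglede's theorem makes all `L j` and their adjoints commute. Some nonzero
traceless Hermitian `X` then commutes with all of them and `𝓓 X = 0`. It is a multiple of a
difference of states that never decays, which contradicts condition 2.

For 3 ↔ 4, Fuglede's theorem again shows that failure of 4 gives a commutative algebra. Conversely,
a noncommutative star subalgebra contains the independent elements 1, A, B, [A, B] and so has full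
dimension four. -/

namespace Lindblad

/-! ### Commutativity and the generated algebra -/

/-- Fuglede's theorem for complex matrices. -/
theorem commute_conjTranspose_of_isStarNormal {n : Type*} [Fintype n] [DecidableEq n]
    {A B : Matrix n n ℂ} (hA : IsStarNormal A) (h : Commute A B) : Commute Aᴴ B := by
  let _ : CStarAlgebra (Matrix n n ℂ) := Matrix.instCStarAlgebra
  exact hA.commute_star_left h

/-- A noncommutative star subalgebra contains two noncommuting Hermitian elements. -/
theorem exists_isHermitian_not_commute {n : Type*} [Fintype n] [DecidableEq n]
    {S : StarSubalgebra ℂ (Matrix n n ℂ)} {P Q : Matrix n n ℂ} (hP : P ∈ S) (hQ : Q ∈ S)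
    (h : ¬ Commute P Q) :
    ∃ A B : Matrix n n ℂ, A ∈ S ∧ B ∈ S ∧ A.IsHermitian ∧ B.IsHermitian ∧ ¬ Commute A B := by
  have parts : ∀ T ∈ S, ∃ A B : Matrix n n ℂ, A ∈ S ∧ B ∈ S ∧ A.IsHermitian ∧ B.IsHermitian ∧
      T = A + Complex.I • B := by
    intro T hT
    refine ⟨realPart T, imaginaryPart T, ?_, ?_, (realPart T).2, (imaginaryPart T).2,
      (realPart_add_I_smul_imaginaryPart T).symm⟩
    · rw [realPart_apply_coe, ← Complex.coe_smul]
      exact SMulMemClass.smul_mem _ (add_mem hT (star_mem hT))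
    · rw [imaginaryPart_apply_coe, ← Complex.coe_smul]
      exact SMulMemClass.smul_mem _ (SMulMemClass.smul_mem _ (sub_mem hT (star_mem hT)))
  by_contra! hc
  obtain ⟨P₁, P₂, hP₁, hP₂, sP₁, sP₂, rfl⟩ := parts P hP
  obtain ⟨Q₁, Q₂, hQ₁, hQ₂, sQ₁, sQ₂, rfl⟩ := parts Q hQ
  refine h (Commute.add_left (Commute.add_right ?_ ?_) (Commute.add_right ?_ ?_))
  · exact hc _ _ hP₁ hQ₁ sP₁ sQ₁
  · exact (hc _ _ hP₁ hQ₂ sP₁ sQ₂).smul_right _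
  · exact (hc _ _ hP₂ hQ₁ sP₂ sQ₁).smul_left _
  · exact ((hc _ _ hP₂ hQ₂ sP₂ sQ₂).smul_right _).smul_left _

/-- Two noncommuting Hermitian matrices, their commutator and the identity are linearly
independent. -/
theorem linearIndependent_of_isHermitian_not_commute {n : Type*} [Fintype n] [DecidableEq n]
    {A B : Matrix n n ℂ} (hA : A.IsHermitian) (hB : B.IsHermitian) (h : ¬ Commute A B) :
    LinearIndependent ℂ ![1, A, B, A * B - B * A] := by
  set C := A * B - B * A with hC
  have hC0 : C ≠ 0 := fun h0 => h (sub_eq_zero.mp h0)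
  have hCH : Cᴴ = -C := by
    simp [hC, Matrix.conjTranspose_sub, Matrix.conjTranspose_mul, hA.eq, hB.eq]
  -- `C` is skew-Hermitian, so this trace is minus its squared Hilbert–Schmidt norm.
  have hCC : (C * C).trace ≠ 0 := by
    intro h0
    refine hC0 (Matrix.trace_conjTranspose_mul_self_eq_zero_iff.mp ?_)
    rw [hCH, Matrix.neg_mul, Matrix.trace_neg, h0, neg_zero]
  have hAC : (A * C).trace = 0 := by
    rw [hC, mul_sub, Matrix.trace_sub, ← mul_assoc, ← mul_assoc, Matrix.trace_mul_comm (A * B) A,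
      ← mul_assoc, sub_self]
  have hBC : (B * C).trace = 0 := by
    rw [hC, mul_sub, Matrix.trace_sub, ← mul_assoc, ← mul_assoc, Matrix.trace_mul_comm (B * B) A,
      mul_assoc B A B, Matrix.trace_mul_comm B (A * B), mul_assoc, sub_self]
  have hCt : C.trace = 0 := by
    rw [hC, Matrix.trace_sub, Matrix.trace_mul_comm, sub_self]
  rw [Fintype.linearIndependent_iff]
  intro g hg
  simp only [Fin.sum_univ_four, Matrix.cons_val] at hg
  -- Under the trace pairing, `C` is orthogonal to 1, `A` and `B` but not to itself. The
  -- coefficients of `B` and `A` are then isolated by commutators with `A` and `B`.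
  have h3 : g 3 = 0 := by
    have := congrArg (fun M => (M * C).trace) hg
    simpa [add_mul, hAC, hBC, hCt, hCC] using this
  rw [h3, zero_smul, add_zero] at hg
  have h2 : g 2 = 0 := by
    have h' : g 2 • C = A * (g 0 • 1 + g 1 • A + g 2 • B) - (g 0 • 1 + g 1 • A + g 2 • B) * A := by
      simp only [hC, mul_add, add_mul, Matrix.mul_smul, Matrix.smul_mul, mul_one, one_mul, smul_sub]
      abel
    rw [hg] at h'
    simpa [hC0] using h'
  have h1 : g 1 = 0 := by
    have h' : g 1 • C = (g 0 • 1 + g 1 • A + g 2 • B) * B - B * (g 0 • 1 + g 1 • A + g 2 • B) := by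
      simp only [hC, mul_add, add_mul, Matrix.mul_smul, Matrix.smul_mul, mul_one, one_mul, smul_sub]
      abel
    rw [hg] at h'
    simpa [hC0] using h'
  have h0 : g 0 = 0 := by
    rw [h1, h2, zero_smul, zero_smul, add_zero, add_zero] at hg
    by_contra hne
    have h1' : (1 : Matrix n n ℂ) = 0 := (smul_eq_zero.mp hg).resolve_left hne
    exact hC0 (by rw [← mul_one C, h1', mul_zero])
  intro i
  fin_cases i <;> assumption

/-- A dimension count: 1, `A`, `B` and their commutator are four independent elements of a
four-dimensional space. -/
theorem starSubalgebra_eq_top_of_not_commute {S : StarSubalgebra ℂ (Matrix (Fin 2) (Fin 2) ℂ)}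
    {P Q : Matrix (Fin 2) (Fin 2) ℂ} (hP : P ∈ S) (hQ : Q ∈ S) (h : ¬ Commute P Q) :
    S.toSubalgebra = ⊤ := by
  obtain ⟨A, B, hA, hB, sA, sB, hAB⟩ := exists_isHermitian_not_commute hP hQ h
  have hspan := (linearIndependent_of_isHermitian_not_commute sA sB hAB
    ).span_eq_top_of_card_eq_finrank' (by simp [Module.finrank_matrix])
  have hle : Submodule.span ℂ (Set.range ![1, A, B, A * B - B * A]) ≤
      Subalgebra.toSubmodule S.toSubalgebra := by
    rw [Submodule.span_le]
    rintro _ ⟨i, rfl⟩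
    fin_cases i
    · exact S.one_mem
    · exact hA
    · exact hB
    · exact S.sub_mem (S.mul_mem hA hB) (S.mul_mem hB hA)
  rw [hspan, top_le_iff] at hle
  exact Algebra.toSubmodule_eq_top.mp hle

theorem adjoin_range_union_conjTranspose_eq {m d : ℕ} (L : Fin m → Matrix (Fin d) (Fin d) ℂ) :
    Algebra.adjoin ℂ (Set.range L ∪ Set.range (fun j => (L j)ᴴ)) =
      (StarAlgebra.adjoin ℂ (Set.range L)).toSubalgebra := by
  rw [StarAlgebra.adjoin_toSubalgebra]
  congr 2
  ext M
  simp only [Set.mem_range, Set.mem_star, ← Matrix.star_eq_conjTranspose]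
  exact exists_congr fun j => by rw [star_eq_iff_star_eq, eq_comm]

theorem adjoin_eq_top_iff {m : ℕ} (L : Fin m → Matrix (Fin 2) (Fin 2) ℂ) :
    Algebra.adjoin ℂ (Set.range L ∪ Set.range (fun j => (L j)ᴴ)) = ⊤ ↔
      (∃ j, ¬ IsStarNormal (L j)) ∨ ∃ j k, ¬ Commute (L j) (L k) := by
  constructor
  · intro htop
    by_contra! hc
    obtain ⟨hn, hcomm⟩ := hc
    have hstar : ∀ j k, Commute (L j)ᴴ (L k) := fun j k =>
      commute_conjTranspose_of_isStarNormal (hn j) (hcomm j k)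
    have hgen : ∀ x ∈ Set.range L ∪ Set.range (fun j => (L j)ᴴ),
        ∀ y ∈ Set.range L ∪ Set.range (fun j => (L j)ᴴ), x * y = y * x := by
      rintro _ (⟨j, rfl⟩ | ⟨j, rfl⟩) _ (⟨k, rfl⟩ | ⟨k, rfl⟩)
      · exact hcomm j k
      · exact (hstar k j).symm
      · exact hstar j k
      · exact (hcomm j k).star_star
    have hmul := Algebra.isMulCommutative_adjoin ℂ hgen
    rw [htop] at hmul
    -- The two off-diagonal matrix units do not commute, so the full algebra is not commutative.
    have h := congrArg Subtype.val (hmul.is_comm.comm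
      (⟨!![0, 1; 0, 0], trivial⟩ : (⊤ : Subalgebra ℂ (Matrix (Fin 2) (Fin 2) ℂ)))
      ⟨!![0, 0; 1, 0], trivial⟩)
    simpa using congrFun (congrFun h 0) 0
  · intro h
    rw [adjoin_range_union_conjTranspose_eq]
    have hL : ∀ j, L j ∈ StarAlgebra.adjoin ℂ (Set.range L) := fun j =>
      StarAlgebra.subset_adjoin ℂ _ ⟨j, rfl⟩
    rcases h with ⟨j, hj⟩ | ⟨j, k, hjk⟩
    · exact starSubalgebra_eq_top_of_not_commute (star_mem (hL j)) (hL j) fun h => hj ⟨h⟩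
    · exact starSubalgebra_eq_top_of_not_commute (hL j) (hL k) hjk

/-- The centralizer of a nonzero traceless `2 × 2` matrix is commutative. -/
theorem commute_of_commute_traceless {X A B : Matrix (Fin 2) (Fin 2) ℂ} (hX : X ≠ 0)
    (htr : X.trace = 0) (hA : Commute X A) (hB : Commute X B) : Commute A B := by
  have hX' : X 0 0 ≠ 0 ∨ X 0 1 ≠ 0 ∨ X 1 0 ≠ 0 := by
    by_contra! hc
    refine hX ?_
    rw [Matrix.trace_fin_two, hc.1, zero_add] at htr
    ext i j
    fin_cases i <;> fin_cases j <;> simp [hc, htr]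
  rw [Matrix.trace_fin_two] at htr
  have entries : ∀ {M : Matrix (Fin 2) (Fin 2) ℂ}, Commute X M →
      X 0 1 * M 1 0 = X 1 0 * M 0 1 ∧ 2 * X 0 0 * M 0 1 = X 0 1 * (M 0 0 - M 1 1) ∧
        2 * X 0 0 * M 1 0 = X 1 0 * (M 0 0 - M 1 1) := by
    intro M hM
    have e : ∀ i j, (X * M) i j = (M * X) i j := fun i j => by rw [hM.eq]
    simp only [Matrix.mul_apply, Fin.sum_univ_two] at e
    have e00 := e 0 0
    have e01 := e 0 1
    have e10 := e 1 0
    refine ⟨?_, ?_, ?_⟩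
    · linear_combination e00
    · linear_combination e01 + M 0 1 * htr
    · linear_combination -e10 + M 1 0 * htr
  obtain ⟨a1, a2, a3⟩ := entries hA
  obtain ⟨b1, b2, b3⟩ := entries hB
  -- `entries` says that (M₀₁, M₁₀, M₀₀ - M₁₁) is parallel to the nonzero vector (X₀₁, X₁₀, 2X₀₀).
  -- The vectors of `A` and `B` are therefore parallel to each other, which is exactly commutation.
  have k1 : A 0 1 * B 1 0 = A 1 0 * B 0 1 := by grind
  have k2 : A 0 1 * (B 0 0 - B 1 1) = B 0 1 * (A 0 0 - A 1 1) := by grind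
  have k3 : A 1 0 * (B 0 0 - B 1 1) = B 1 0 * (A 0 0 - A 1 1) := by grind
  ext i j
  fin_cases i <;> fin_cases j <;> simp only [Matrix.mul_apply, Fin.sum_univ_two, Fin.zero_eta,
    Fin.mk_one, Fin.isValue]
  · linear_combination k1
  · linear_combination -k2
  · linear_combination k3
  · linear_combination -k1

/-! ### Bloch coordinates and traceless Hermitian matrices -/

/-- The Bloch coordinates of a `2 × 2` matrix. -/
def blochCoord (X : Matrix (Fin 2) (Fin 2) ℂ) : Fin 3 → ℝ :=
  ![(X 0 0).re, (X 0 1).re, (X 0 1).im]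

/-- Traceless Hermitian matrices. -/
def IsTracelessHermitian (X : Matrix (Fin 2) (Fin 2) ℂ) : Prop :=
  X.IsHermitian ∧ X.trace = 0

/-- The traceless Hermitian matrix with given Bloch coordinates. -/
def blochMatrix (v : Fin 3 → ℝ) : Matrix (Fin 2) (Fin 2) ℂ :=
  !![(v 0 : ℂ), v 1 + v 2 * Complex.I; v 1 - v 2 * Complex.I, -(v 0 : ℂ)]

theorem isTracelessHermitian_iff {X : Matrix (Fin 2) (Fin 2) ℂ} :
    IsTracelessHermitian X ↔
      (X 0 0).im = 0 ∧ X 1 1 = -X 0 0 ∧ X 1 0 = starRingEnd ℂ (X 0 1) := by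
  constructor
  · rintro ⟨h, ht⟩
    rw [Matrix.trace_fin_two] at ht
    exact ⟨Complex.conj_eq_iff_im.mp (h.apply 0 0), by linear_combination ht, (h.apply 1 0).symm⟩
  · rintro ⟨h0, h1, h2⟩
    have h0' : starRingEnd ℂ (X 0 0) = X 0 0 := Complex.conj_eq_iff_im.mpr h0
    refine ⟨?_, by rw [Matrix.trace_fin_two, h1, add_neg_cancel]⟩
    ext i j
    fin_cases i <;> fin_cases j <;> simp [Matrix.conjTranspose_apply, h0', h1, h2]

theorem blochMatrix_blochCoord {X : Matrix (Fin 2) (Fin 2) ℂ} (hX : IsTracelessHermitian X) :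
    blochMatrix (blochCoord X) = X := by
  obtain ⟨h0, h1, h2⟩ := isTracelessHermitian_iff.mp hX
  ext i j
  fin_cases i <;> fin_cases j <;>
    simp [blochMatrix, blochCoord, h1, h2, Complex.ext_iff, h0]

theorem isTracelessHermitian_blochMatrix (v : Fin 3 → ℝ) :
    IsTracelessHermitian (blochMatrix v) := by
  rw [isTracelessHermitian_iff]
  simp [blochMatrix, sub_eq_add_neg]

theorem blochMatrix_injective : Function.Injective blochMatrix := by
  intro v w h
  have h0 := congrFun (congrFun h 0) 0
  have h1 := congrFun (congrFun h 0) 1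
  simp only [blochMatrix, Matrix.of_apply, Matrix.cons_val', Matrix.cons_val_zero,
    Matrix.cons_val_one, Complex.ext_iff] at h0 h1
  ext i
  fin_cases i
  · simpa using h0.1
  · simpa using h1.1
  · simpa using h1.2

theorem IsTracelessHermitian.mul_self {X : Matrix (Fin 2) (Fin 2) ℂ}
    (hX : IsTracelessHermitian X) :
    X * X = ((∑ i, blochCoord X i ^ 2 : ℝ) : ℂ) • (1 : Matrix (Fin 2) (Fin 2) ℂ) := by
  obtain ⟨h0, h1, h2⟩ := isTracelessHermitian_iff.mp hX
  ext i j
  fin_cases i <;> fin_cases j <;>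
    simp [Matrix.mul_apply, Fin.sum_univ_two, Fin.sum_univ_three, blochCoord, h1, h2,
      Complex.ext_iff, h0, pow_two] <;> ring_nf <;> simp

/-- Since `Xᴴ * X = X * X` is scalar, both singular values equal the Bloch length. -/
theorem IsTracelessHermitian.traceNorm_eq {X : Matrix (Fin 2) (Fin 2) ℂ}
    (hX : IsTracelessHermitian X) : traceNorm X = 2 * √(∑ i, blochCoord X i ^ 2) := by
  have hev : ∀ i, (Matrix.isHermitian_conjTranspose_mul_self X).eigenvalues i =
      ∑ i, blochCoord X i ^ 2 := by
    intro i
    have hA := Matrix.isHermitian_conjTranspose_mul_self X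
    have h := hA.mulVec_eigenvectorBasis i
    nth_rewrite 1 [hX.1.eq] at h
    rw [hX.mul_self, Matrix.smul_mulVec, Matrix.one_mulVec] at h
    have hne : (hA.eigenvectorBasis i).ofLp ≠ 0 := fun h0 =>
      hA.eigenvectorBasis.orthonormal.ne_zero i (by ext j; simp [h0])
    have h' : (((∑ i, blochCoord X i ^ 2 : ℝ) : ℂ) - (hA.eigenvalues i : ℂ)) •
        (hA.eigenvectorBasis i).ofLp = 0 := by
      rw [sub_smul, h, Complex.coe_smul, sub_self]
    have := (smul_eq_zero.mp h').resolve_right hne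
    exact_mod_cast (sub_eq_zero.mp this).symm
  simp only [traceNorm, hev, Fin.sum_univ_two]
  ring

theorem IsState.sub_isTracelessHermitian {ρ σ : Matrix (Fin 2) (Fin 2) ℂ} (hρ : IsState ρ)
    (hσ : IsState σ) : IsTracelessHermitian (ρ - σ) :=
  ⟨hρ.1.isHermitian.sub hσ.1.isHermitian, by rw [Matrix.trace_sub, hρ.2, hσ.2, sub_self]⟩

theorem IsTracelessHermitian.add {X Y : Matrix (Fin 2) (Fin 2) ℂ} (hX : IsTracelessHermitian X)
    (hY : IsTracelessHermitian Y) : IsTracelessHermitian (X + Y) :=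
  ⟨hX.1.add hY.1, by rw [Matrix.trace_add, hX.2, hY.2, add_zero]⟩

theorem IsTracelessHermitian.sum {ι : Type*} {s : Finset ι}
    {X : ι → Matrix (Fin 2) (Fin 2) ℂ} (hX : ∀ i ∈ s, IsTracelessHermitian (X i)) :
    IsTracelessHermitian (∑ i ∈ s, X i) :=
  Finset.sum_induction _ _ (fun _ _ => IsTracelessHermitian.add)
    ⟨Matrix.isHermitian_zero, Matrix.trace_zero _ _⟩ hX

theorem IsTracelessHermitian.jumpDissipator {X : Matrix (Fin 2) (Fin 2) ℂ}
    (hX : IsTracelessHermitian X) (L : Matrix (Fin 2) (Fin 2) ℂ) :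
    IsTracelessHermitian (jumpDissipator L X) := by
  change IsTracelessHermitian (L * X * Lᴴ - (1 / 2 : ℂ) • (Lᴴ * L * X + X * (Lᴴ * L)))
  constructor
  · rw [Matrix.IsHermitian]
    simp [Matrix.conjTranspose_sub, Matrix.conjTranspose_mul, hX.1.eq, mul_assoc, add_comm]
  · rw [Matrix.trace_sub, Matrix.trace_smul, Matrix.trace_add, Matrix.trace_mul_comm X,
      Matrix.trace_mul_comm (L * X), ← mul_assoc, smul_eq_mul]
    ring

theorem IsTracelessHermitian.dissipator {m : ℕ} {X : Matrix (Fin 2) (Fin 2) ℂ}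
    (hX : IsTracelessHermitian X) (L : Fin m → Matrix (Fin 2) (Fin 2) ℂ) :
    IsTracelessHermitian (dissipator L X) := by
  rw [Lindblad.dissipator, LinearMap.sum_apply]
  exact IsTracelessHermitian.sum fun j _ => hX.jumpDissipator (L j)

theorem IsTracelessHermitian.hamiltonianPart {X H : Matrix (Fin 2) (Fin 2) ℂ}
    (hX : IsTracelessHermitian X) (hH : H.IsHermitian) :
    IsTracelessHermitian (hamiltonianPart H X) := by
  change IsTracelessHermitian ((-Complex.I) • (H * X - X * H))
  constructor
  · rw [Matrix.IsHermitian]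
    simp [Matrix.conjTranspose_mul, hX.1.eq, hH.eq, smul_sub, add_comm]
  · rw [Matrix.trace_smul, Matrix.trace_sub, Matrix.trace_mul_comm, sub_self, smul_zero]

/-! ### Dissipation rate -/

/-- The dot product of Bloch vectors is half the trace pairing, and tr(X[H, X]) = 0 by cyclicity:
Hamiltonians only rotate the Bloch ball. -/
theorem blochCoord_dot_hamiltonianPart {X H : Matrix (Fin 2) (Fin 2) ℂ}
    (hX : IsTracelessHermitian X) (hH : H.IsHermitian) :
    ∑ i, blochCoord X i * blochCoord (hamiltonianPart H X) i = 0 := by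
  obtain ⟨h0, h1, h2⟩ := isTracelessHermitian_iff.mp hX
  have k0 : (H 0 0).im = 0 := Complex.conj_eq_iff_im.mp (hH.apply 0 0)
  have k1 : (H 1 1).im = 0 := Complex.conj_eq_iff_im.mp (hH.apply 1 1)
  have k2 : H 1 0 = starRingEnd ℂ (H 0 1) := (hH.apply 1 0).symm
  change ∑ i, blochCoord X i * blochCoord ((-Complex.I) • (H * X - X * H)) i = 0
  simp [Fin.sum_univ_three, blochCoord, Matrix.mul_apply, h0, h1, h2, k0, k1, k2]
  ring

/-- The dissipation rate of the Hilbert–Schmidt norm of a traceless Hermitian `2 × 2` matrix is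
given by the Hilbert–Schmidt norm of its commutator with the jump operator. -/
theorem blochCoord_dot_jumpDissipator {X : Matrix (Fin 2) (Fin 2) ℂ}
    (hX : IsTracelessHermitian X) (L : Matrix (Fin 2) (Fin 2) ℂ) :
    ∑ i, blochCoord X i * blochCoord (jumpDissipator L X) i =
      -(1 / 4) * ∑ a, ∑ b, Complex.normSq ((X * L - L * X) a b) := by
  obtain ⟨h0, h1, h2⟩ := isTracelessHermitian_iff.mp hX
  change ∑ i, blochCoord X i *
    blochCoord (L * X * Lᴴ - (1 / 2 : ℂ) • (Lᴴ * L * X + X * (Lᴴ * L))) i = _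
  have half : (1 / 2 : ℂ) = ((1 / 2 : ℝ) : ℂ) := by norm_num
  rw [half]
  simp only [Fin.sum_univ_three, Fin.sum_univ_two, blochCoord, Matrix.mul_apply, h0, h1, h2,
    Matrix.sub_apply, Matrix.add_apply, Matrix.smul_apply, Matrix.conjTranspose_apply,
    Matrix.cons_val, Complex.normSq_apply, Complex.sub_re, Complex.sub_im, Complex.add_re,
    Complex.add_im, Complex.mul_re, Complex.mul_im, Complex.neg_re, Complex.neg_im,
    Complex.conj_re, Complex.conj_im, Complex.star_def, smul_eq_mul, Complex.ofReal_re,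
    Complex.ofReal_im]
  ring

/-- A continuous function that is homogeneous of degree two and positive away from the origin
dominates a multiple of the squared norm. -/
theorem exists_pos_mul_norm_sq_le {E : Type*} [NormedAddCommGroup E] [NormedSpace ℝ E]
    [ProperSpace E] {q : E → ℝ} (hc : Continuous q) (hq : ∀ (c : ℝ) x, q (c • x) = c ^ 2 * q x)
    (hpos : ∀ x, x ≠ 0 → 0 < q x) : ∃ γ : ℝ, 0 < γ ∧ ∀ x, γ * ‖x‖ ^ 2 ≤ q x := by
  have hq0 : q 0 = 0 := by simpa using hq 0 0
  rcases (Metric.sphere (0 : E) 1).eq_empty_or_nonempty with hS | hS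
  -- The unit sphere is empty only when `E` is trivial, so any positive constant serves.
  · refine ⟨1, one_pos, fun x => ?_⟩
    by_cases hx : x = 0
    · simp [hx, hq0]
    · have : (‖x‖⁻¹ • x) ∈ Metric.sphere (0 : E) 1 := by
        simp [norm_smul, hx]
      rw [hS] at this
      exact this.elim
  · obtain ⟨y, hy, hmin⟩ := (isCompact_sphere (0 : E) 1).exists_isMinOn hS hc.continuousOn
    have hy0 : y ≠ 0 := by
      rintro rfl
      simp at hy
    refine ⟨q y, hpos y hy0, fun x => ?_⟩
    by_cases hx : x = 0
    · simp [hx, hq0]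
    · have hmem : (‖x‖⁻¹ • x) ∈ Metric.sphere (0 : E) 1 := by
        simp [norm_smul, hx]
      have h : q y ≤ q (‖x‖⁻¹ • x) := hmin hmem
      rw [hq, inv_pow, inv_mul_eq_div, le_div_iff₀ (by positivity)] at h
      exact h

theorem blochCoord_dot_dissipator {m : ℕ} {X : Matrix (Fin 2) (Fin 2) ℂ}
    (hX : IsTracelessHermitian X) (L : Fin m → Matrix (Fin 2) (Fin 2) ℂ) :
    ∑ i, blochCoord X i * blochCoord (dissipator L X) i =
      -(1 / 4) * ∑ j, ∑ a, ∑ b, Complex.normSq ((X * L j - L j * X) a b) := by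
  have hsum : ∀ i, blochCoord (dissipator L X) i = ∑ j, blochCoord (jumpDissipator (L j) X) i := by
    intro i
    rw [dissipator, LinearMap.sum_apply]
    fin_cases i <;> simp [blochCoord, Matrix.sum_apply]
  simp only [hsum, Finset.mul_sum]
  rw [Finset.sum_comm]
  refine Finset.sum_congr rfl fun j _ => ?_
  simpa only [Finset.mul_sum] using blochCoord_dot_jumpDissipator hX (L j)

/-- If the jump operators are not simultaneously unitarily diagonalizable, the dissipator is
uniformly strictly dissipative on traceless Hermitian matrices. -/
theorem exists_dissipation_rate {m : ℕ} {L : Fin m → Matrix (Fin 2) (Fin 2) ℂ}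
    (h : (∃ j, ¬ IsStarNormal (L j)) ∨ ∃ j k, ¬ Commute (L j) (L k)) :
    ∃ γ : ℝ, 0 < γ ∧ ∀ X, IsTracelessHermitian X →
      ∑ i, blochCoord X i * blochCoord (dissipator L X) i ≤ -γ * ∑ i, blochCoord X i ^ 2 := by
  let q : EuclideanSpace ℝ (Fin 3) → ℝ := fun v => ∑ j, ∑ a, ∑ b,
    Complex.normSq ((blochMatrix v.ofLp * L j - L j * blochMatrix v.ofLp) a b)
  have hcont : Continuous q := by
    have hb : Continuous fun v : EuclideanSpace ℝ (Fin 3) => blochMatrix v.ofLp := by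
      refine continuous_matrix fun i j => ?_
      fin_cases i <;> fin_cases j <;> simp [blochMatrix] <;> fun_prop
    refine continuous_finsetSum _ fun j _ => continuous_finsetSum _ fun a _ =>
      continuous_finsetSum _ fun b _ => Complex.continuous_normSq.comp ?_
    exact ((hb.mul continuous_const).sub (continuous_const.mul hb)).matrix_elem a b
  have hhom : ∀ (c : ℝ) v, q (c • v) = c ^ 2 * q v := by
    intro c v
    have hb : blochMatrix (c • v).ofLp = (c : ℂ) • blochMatrix v.ofLp := by
      ext i j
      fin_cases i <;> fin_cases j <;> simp [blochMatrix] <;> ring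
    simp only [q, hb, Matrix.smul_mul, Matrix.mul_smul, ← smul_sub, Matrix.smul_apply, smul_eq_mul,
      Complex.normSq_mul, Complex.normSq_ofReal, Finset.mul_sum, pow_two]
  have hpos : ∀ v, v ≠ 0 → 0 < q v := by
    intro v hv
    have hnn : ∀ j a b, 0 ≤ Complex.normSq
        ((blochMatrix v.ofLp * L j - L j * blochMatrix v.ofLp) a b) :=
      fun j a b => Complex.normSq_nonneg _
    refine lt_of_le_of_ne (Finset.sum_nonneg fun j _ => Finset.sum_nonneg fun a _ =>
      Finset.sum_nonneg fun b _ => hnn j a b) fun h0 => ?_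
    have hX := isTracelessHermitian_blochMatrix v.ofLp
    have hX0 : blochMatrix v.ofLp ≠ 0 := by
      intro hz
      refine hv (WithLp.ofLp_injective 2 (blochMatrix_injective ?_))
      rw [hz]
      ext i j
      fin_cases i <;> fin_cases j <;> simp [blochMatrix]
    have hcomm : ∀ j, Commute (blochMatrix v.ofLp) (L j) := by
      intro j
      have h1 := (Finset.sum_eq_zero_iff_of_nonneg fun j _ => Finset.sum_nonneg fun a _ =>
        Finset.sum_nonneg fun b _ => hnn j a b).mp h0.symm j (Finset.mem_univ j)
      refine sub_eq_zero.mp (Matrix.ext fun a b => ?_)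
      have h2 := (Finset.sum_eq_zero_iff_of_nonneg fun a _ =>
        Finset.sum_nonneg fun b _ => hnn j a b).mp h1 a (Finset.mem_univ a)
      have h3 := (Finset.sum_eq_zero_iff_of_nonneg fun b _ => hnn j a b).mp h2 b
        (Finset.mem_univ b)
      exact Complex.normSq_eq_zero.mp h3
    rcases h with ⟨j, hj⟩ | ⟨j, k, hjk⟩
    · refine hj ⟨commute_of_commute_traceless hX0 hX.2 ?_ (hcomm j)⟩
      -- As `X` is Hermitian, it also commutes with the adjoint of `L j`; both lie in its
      -- commutative centralizer.
      have := (hcomm j).star_star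
      rwa [Matrix.star_eq_conjTranspose (blochMatrix _), hX.1.eq] at this
    · exact hjk (commute_of_commute_traceless hX0 hX.2 (hcomm j) (hcomm k))
  obtain ⟨γ, hγ, hle⟩ := exists_pos_mul_norm_sq_le hcont hhom hpos
  refine ⟨γ / 4, by positivity, fun X hX => ?_⟩
  have h1 := hle (WithLp.toLp 2 (blochCoord X))
  simp only [EuclideanSpace.real_norm_sq_eq, q, blochMatrix_blochCoord hX] at h1
  rw [blochCoord_dot_dissipator hX]
  linarith

/-! ### Stationary directions when the jump operators are normal and commute -/

/-- Commuting normal `2 × 2` matrices commute with a common nonzero traceless Hermitian matrix. -/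
theorem exists_isTracelessHermitian_commute {ι : Type*} {L : ι → Matrix (Fin 2) (Fin 2) ℂ}
    (hn : ∀ j, IsStarNormal (L j)) (hc : ∀ j k, Commute (L j) (L k)) :
    ∃ X, IsTracelessHermitian X ∧ X ≠ 0 ∧ ∀ j, Commute X (L j) := by
  have of_hermitian : ∀ A : Matrix (Fin 2) (Fin 2) ℂ, A.IsHermitian → (∀ j, Commute A (L j)) →
      (A ≠ (A.trace / 2) • (1 : Matrix (Fin 2) (Fin 2) ℂ)) →
        ∃ X, IsTracelessHermitian X ∧ X ≠ 0 ∧ ∀ j, Commute X (L j) := by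
    intro A hA hAL hne
    refine ⟨A - (A.trace / 2) • 1, ⟨?_, ?_⟩, sub_ne_zero.mpr hne, fun j =>
      (hAL j).sub_left ((Commute.one_left _).smul_left _)⟩
    · have htr : starRingEnd ℂ A.trace = A.trace := by
        rw [← Complex.star_def, ← Matrix.trace_conjTranspose, hA.eq]
      rw [Matrix.IsHermitian, Matrix.conjTranspose_sub, Matrix.conjTranspose_smul, hA.eq]
      simp [htr]
    · simp [Matrix.trace_sub]
  by_contra hno
  have scalar_of : ∀ A : Matrix (Fin 2) (Fin 2) ℂ, A.IsHermitian → (∀ j, Commute A (L j)) →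
      A = (A.trace / 2) • (1 : Matrix (Fin 2) (Fin 2) ℂ) := fun A hA hAL => by
    by_contra hne
    exact hno (of_hermitian A hA hAL hne)
  have hL : ∀ j, ∃ c : ℂ, L j = c • (1 : Matrix (Fin 2) (Fin 2) ℂ) := by
    intro j
    have hs : ∀ k, Commute (star (L j)) (L k) := fun k =>
      commute_conjTranspose_of_isStarNormal (hn j) (hc j k)
    obtain ⟨a, ha⟩ : ∃ a : ℂ, (realPart (L j) : Matrix (Fin 2) (Fin 2) ℂ) = a • 1 :=
      ⟨_, scalar_of (realPart (L j)) (realPart (L j)).2 fun k => by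
      rw [realPart_apply_coe]
      exact ((hc j k).add_left (hs k)).smul_left _⟩
    obtain ⟨b, hb⟩ : ∃ b : ℂ, (imaginaryPart (L j) : Matrix (Fin 2) (Fin 2) ℂ) = b • 1 :=
      ⟨_, scalar_of (imaginaryPart (L j)) (imaginaryPart (L j)).2 fun k => by
      rw [imaginaryPart_apply_coe]
      exact (((hc j k).sub_left (hs k)).smul_left _).smul_left _⟩
    refine ⟨a + Complex.I * b, ?_⟩
    rw [← realPart_add_I_smul_imaginaryPart (L j), ha, hb, smul_smul, ← add_smul]
  -- Once every `L j` is scalar, any nonzero traceless Hermitian matrix works; this one is diag(1,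
  -- -1).
  refine hno ⟨blochMatrix ![1, 0, 0], isTracelessHermitian_blochMatrix _, fun h0 => ?_, fun j => ?_⟩
  · simpa [blochMatrix] using congrFun (congrFun h0 0) 0
  · obtain ⟨c, hcj⟩ := hL j
    rw [hcj]
    exact (Commute.one_right _).smul_right c

/-- `X` can be moved past `L j` and its adjoint, and normality then makes the gain and loss terms
cancel. -/
theorem dissipator_eq_zero_of_commute {m d : ℕ} {L : Fin m → Matrix (Fin d) (Fin d) ℂ}
    (hn : ∀ j, IsStarNormal (L j)) {X : Matrix (Fin d) (Fin d) ℂ} (hX : X.IsHermitian)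
    (hc : ∀ j, Commute X (L j)) : dissipator L X = 0 := by
  rw [dissipator, LinearMap.sum_apply]
  refine Finset.sum_eq_zero fun j _ => ?_
  change L j * X * (L j)ᴴ - (1 / 2 : ℂ) • ((L j)ᴴ * L j * X + X * ((L j)ᴴ * L j)) = 0
  have h2 : X * (L j)ᴴ = (L j)ᴴ * X := by
    have := (hc j).star_star
    rw [Matrix.star_eq_conjTranspose, Matrix.star_eq_conjTranspose, hX.eq] at this
    exact this.eq
  have h3 : (L j)ᴴ * L j = L j * (L j)ᴴ := (hn j).star_comm_self
  have e1 : L j * X * (L j)ᴴ = X * ((L j)ᴴ * L j) := by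
    rw [← (hc j).eq, mul_assoc, h3]
  have e2 : (L j)ᴴ * L j * X = X * ((L j)ᴴ * L j) := by
    rw [mul_assoc, ← (hc j).eq, ← mul_assoc, ← h2, mul_assoc]
  rw [e1, e2, ← two_smul ℂ, smul_smul]
  norm_num

theorem evolution_const_of_apply_eq_zero {d : ℕ} {𝓓 : Module.End ℂ (Matrix (Fin d) (Fin d) ℂ)}
    {X : Matrix (Fin d) (Fin d) ℂ} (hX : 𝓓 X = 0) (t s : ℝ) :
    evolution (fun _ => 𝓓) t s X = X := by
  have hD : ∀ n t, dysonTerm (fun _ => 𝓓) s X (n + 1) t = 0 := by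
    intro n
    induction n with
    | zero =>
      intro t
      ext i j
      simp [dysonTerm, hX]
    | succ n ih =>
      intro t
      ext i j
      rw [dysonTerm]
      simp [ih]
  rw [evolution, tsum_eq_single 0]
  · rfl
  · intro n hn
    obtain ⟨k, rfl⟩ := Nat.exists_eq_succ_of_ne_zero hn
    exact hD k t

/-- A traceless Hermitian matrix is a real multiple of a difference of states. -/
theorem IsTracelessHermitian.exists_states {X : Matrix (Fin 2) (Fin 2) ℂ}
    (hX : IsTracelessHermitian X) :
    ∃ (c : ℝ) (ρ σ : Matrix (Fin 2) (Fin 2) ℂ), IsState ρ ∧ IsState σ ∧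
      X = (c : ℂ) • (ρ - σ) := by
  set r : ℝ := √(∑ i, blochCoord X i ^ 2) with hr
  have hsq : X * X = ((r ^ 2 : ℝ) : ℂ) • (1 : Matrix (Fin 2) (Fin 2) ℂ) := by
    rw [hX.mul_self, hr, Real.sq_sqrt (Finset.sum_nonneg fun i _ => sq_nonneg _)]
  -- With `ε = ±1 / r` the matrix `ε • X` squares to 1, so `(1 + ε • X) / 2` is a projection; these
  -- two are the spectral projections of `X`.
  have state : ∀ ε : ℝ, (ε * r) ^ 2 = 1 → IsState ((1 / 2 : ℂ) • (1 + (ε : ℂ) • X)) := by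
    intro ε hε
    set P : Matrix (Fin 2) (Fin 2) ℂ := (1 / 2 : ℂ) • (1 + (ε : ℂ) • X) with hP
    have hPH : Pᴴ = P := by
      simp [hP, hX.1.eq]
    have hPP : P * P = P := by
      have hε' : ((ε : ℂ) * ε) * ((r ^ 2 : ℝ) : ℂ) = 1 := by
        norm_cast
        rw [← hε]
        ring
      rw [hP]
      simp only [Matrix.smul_mul, Matrix.mul_smul, add_mul, mul_add, one_mul, mul_one, hsq,
        smul_smul, smul_add]
      have hc : (1 / 2 * (ε * (1 / 2 * (ε * ((r ^ 2 : ℝ) : ℂ)))) : ℂ) = 1 / 4 := by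
        linear_combination hε' / 4
      simp only [mul_assoc, hc]
      module
    refine ⟨?_, ?_⟩
    · have := Matrix.posSemidef_conjTranspose_mul_self P
      rwa [hPH, hPP] at this
    · simp [hP, hX.2]
  by_cases hr0 : r = 0
  · have hX0 : X = 0 := by
      refine Matrix.trace_conjTranspose_mul_self_eq_zero_iff.mp ?_
      rw [hX.1.eq, hsq, hr0]
      simp
    have hst : IsState ((1 / 2 : ℂ) • (1 : Matrix (Fin 2) (Fin 2) ℂ)) := by
      refine ⟨Matrix.PosSemidef.one.smul ?_, by simp⟩
      rw [Complex.nonneg_iff]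
      norm_num
    exact ⟨0, _, _, hst, hst, by simp [hX0]⟩
  · refine ⟨r, _, _, state r⁻¹ (by field_simp), state (-r⁻¹) (by field_simp), ?_⟩
    have : (r : ℂ) ≠ 0 := by exact_mod_cast hr0
    rw [← smul_sub, add_sub_add_left_eq_sub, ← sub_smul, smul_smul, smul_smul]
    push_cast
    field_simp
    norm_num

theorem not_isExpContractive_of_isStarNormal {m : ℕ} {L : Fin m → Matrix (Fin 2) (Fin 2) ℂ}
    (hn : ∀ j, IsStarNormal (L j)) (hc : ∀ j k, Commute (L j) (L k)) :
    ¬ IsExpContractive (fun _ => dissipator L) := by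
  rintro ⟨K, γ, hK, hγ, hcontr⟩
  obtain ⟨X, hX, hX0, hXL⟩ := exists_isTracelessHermitian_commute hn hc
  obtain ⟨c, ρ, σ, hρ, hσ, rfl⟩ := hX.exists_states
  obtain ⟨hc0, hne⟩ := smul_ne_zero_iff.mp hX0
  have hY := hρ.sub_isTracelessHermitian hσ
  have hDY : dissipator L (ρ - σ) = 0 := by
    have := dissipator_eq_zero_of_commute hn hX.1 hXL
    rw [map_smul] at this
    exact (smul_eq_zero.mp this).resolve_left hc0
  have hpos : 0 < traceNorm (ρ - σ) := by
    rw [hY.traceNorm_eq]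
    have : 0 < ∑ i, blochCoord (ρ - σ) i ^ 2 := by
      refine lt_of_le_of_ne (Finset.sum_nonneg fun i _ => sq_nonneg _) fun h0 => hne ?_
      refine Matrix.trace_conjTranspose_mul_self_eq_zero_iff.mp ?_
      rw [hY.1.eq, hY.mul_self, ← h0]
      simp
    positivity
  have hlim : Filter.Tendsto (fun t : ℝ => K * Real.exp (-γ * t)) Filter.atTop (nhds (K * 0)) := by
    refine (Real.tendsto_exp_atBot.comp ?_).const_mul K
    exact Filter.tendsto_id.const_mul_atTop_of_neg (neg_lt_zero.mpr hγ)
  rw [mul_zero] at hlim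
  -- At a time with `K * exp (-γ * t) < 1` the bound contradicts stationarity of `ρ - σ`.
  obtain ⟨t, ht1, ht0⟩ :=
    ((hlim.eventually_lt_const one_pos).and (Filter.eventually_ge_atTop 0)).exists
  have h := hcontr ρ σ hρ hσ 0 t le_rfl ht0
  rw [evolution_const_of_apply_eq_zero hDY, sub_zero, abs_of_nonneg ht0] at h
  nlinarith

/-! ### Calculus for absolutely continuous curves -/

/-- The fundamental theorem of calculus for `(∫ g) ^ n / n!`, for integrable `g`. -/
theorem integral_mul_pow_div_factorial {g : ℝ → ℝ} {s t : ℝ} (hg : IntervalIntegrable g volume s t)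
    (n : ℕ) :
    ∫ τ in s..t, g τ * ((∫ u in s..τ, g u) ^ n / (n.factorial : ℝ)) =
      (∫ u in s..t, g u) ^ (n + 1) / ((n + 1).factorial : ℝ) := by
  set G : ℝ → ℝ := fun τ => ∫ u in s..τ, g u with hG
  -- `g` is merely integrable, so the chain rule for powers of `G` holds only almost everywhere;
  -- absolute continuity is what allows integrating it back.
  have hac : AbsolutelyContinuousOnInterval G s t :=
    hg.absolutelyContinuousOnInterval_intervalIntegral Set.left_mem_uIcc
  have hpow : ∀ k : ℕ, AbsolutelyContinuousOnInterval (fun τ => G τ ^ (k + 1)) s t := by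
    intro k
    induction k with
    | zero => simpa using hac
    | succ k ih =>
      simp only [pow_succ _ (k + 1)]
      exact ih.fun_mul hac
  have h := ((hpow n).const_mul (((n + 1).factorial : ℝ)⁻¹)).integral_deriv_eq_sub
  have hGs : G s = 0 := intervalIntegral.integral_same
  simp only [hGs] at h
  rw [zero_pow n.succ_ne_zero, mul_zero, sub_zero] at h
  rw [div_eq_inv_mul, ← h]
  refine intervalIntegral.integral_congr_ae ?_
  filter_upwards [hg.ae_hasDerivAt_integral] with x hx hxm
  have hd := hx (Set.uIoc_subset_uIcc hxm) s Set.left_mem_uIcc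
  have hd' := (hd.pow (n + 1)).const_mul (((n + 1).factorial : ℝ)⁻¹)
  refine Eq.trans ?_ hd'.deriv.symm
  rw [Nat.factorial_succ]
  push_cast
  have h1 : (n.factorial : ℝ) ≠ 0 := by positivity
  have h2 : (n + 1 : ℝ) ≠ 0 := by positivity
  field_simp

/-- A Grönwall inequality for the squared Euclidean norm of an absolutely continuous curve. -/
theorem sum_sq_le_exp_mul_of_integral_eq {ι : Type*} [Fintype ι] {F f : ι → ℝ → ℝ} {s T γ : ℝ}
    (hsT : s ≤ T) (hf : ∀ k, IntervalIntegrable (f k) volume s T)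
    (hF : ∀ k, ∀ t ∈ Set.Icc s T, F k t = F k s + ∫ τ in s..t, f k τ)
    (hd : ∀ t ∈ Set.Icc s T, ∑ k, F k t * f k t ≤ -γ * ∑ k, F k t ^ 2) :
    ∑ k, F k T ^ 2 ≤ Real.exp (-2 * γ * (T - s)) * ∑ k, F k s ^ 2 := by
  -- `F` is controlled only on `[s, T]`. `G` agrees with it there and is defined by the integral
  -- everywhere, so two-sided derivatives make sense. `e` below is the integrating factor.
  let G : ι → ℝ → ℝ := fun k t => F k s + ∫ τ in s..t, f k τ
  let e : ℝ → ℝ := fun t => Real.exp (2 * γ * t)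
  have he : AbsolutelyContinuousOnInterval e s T := by
    refine ContDiffOn.absolutelyContinuousOnInterval (ContDiff.contDiffOn ?_)
    fun_prop
  have hG : ∀ k, AbsolutelyContinuousOnInterval (G k) s T := by
    intro k
    have hconst : AbsolutelyContinuousOnInterval (fun _ : ℝ => F k s) s T :=
      ContDiffOn.absolutelyContinuousOnInterval contDiffOn_const
    exact hconst.add ((hf k).absolutelyContinuousOnInterval_intervalIntegral Set.left_mem_uIcc)
  have hP : ∀ k, AbsolutelyContinuousOnInterval (fun t => e t * (G k t * G k t)) s T :=
    fun k => he.fun_mul ((hG k).fun_mul (hG k))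
  have hderiv : ∀ᵐ t, t ∈ Set.Ioc s T → ∀ k, deriv (fun t => e t * (G k t * G k t)) t =
      e t * (2 * (F k t * f k t) + 2 * γ * F k t ^ 2) := by
    have hall : ∀ᵐ t, ∀ k, t ∈ Set.uIcc s T →
        ∀ c ∈ Set.uIcc s T, HasDerivAt (fun x => ∫ u in c..x, f k u) (f k t) t :=
      ae_all_iff.mpr fun k => (hf k).ae_hasDerivAt_integral
    filter_upwards [hall] with t ht htm k
    have htI : t ∈ Set.Icc s T := Set.Ioc_subset_Icc_self htm
    have hGd : HasDerivAt (G k) (f k t) t :=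
      (ht k (by rwa [Set.uIcc_of_le hsT]) s Set.left_mem_uIcc).const_add _
    have hed : HasDerivAt e (Real.exp (2 * γ * t) * (2 * γ)) t := by
      simpa using ((hasDerivAt_id t).const_mul (2 * γ)).exp
    rw [(hed.fun_mul (hGd.fun_mul hGd)).deriv]
    have : G k t = F k t := (hF k t htI).symm
    rw [this]
    simp only [e]
    ring
  have hint : ∑ k, (e T * (G k T * G k T) - e s * (G k s * G k s)) ≤ 0 := by
    have h1 : ∑ k, (e T * (G k T * G k T) - e s * (G k s * G k s)) =
        ∫ t in s..T, ∑ k, deriv (fun t => e t * (G k t * G k t)) t := by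
      rw [intervalIntegral.integral_finsetSum fun k _ => (hP k).intervalIntegrable_deriv]
      exact Finset.sum_congr rfl fun k _ => (hP k).integral_deriv_eq_sub.symm
    rw [h1, intervalIntegral.integral_of_le hsT]
    refine integral_nonpos_of_ae ((ae_restrict_iff' measurableSet_Ioc).mpr ?_)
    filter_upwards [hderiv] with t ht htm
    simp only [ht htm, Pi.zero_apply, ← Finset.mul_sum, Finset.sum_add_distrib]
    have := hd t (Set.Ioc_subset_Icc_self htm)
    exact mul_nonpos_of_nonneg_of_nonpos (Real.exp_pos _).le (by linarith)
  have hGT : ∀ k, G k T = F k T := fun k => (hF k T ⟨hsT, le_rfl⟩).symm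
  have hGs : ∀ k, G k s = F k s := fun k => (hF k s ⟨le_rfl, hsT⟩).symm
  simp only [hGT, hGs, Finset.sum_sub_distrib, ← Finset.mul_sum, ← pow_two] at hint
  have hexp : Real.exp (-2 * γ * (T - s)) * e T = e s := by
    simp only [e]
    rw [← Real.exp_add]
    congr 1
    ring
  have hpos : 0 < e T := Real.exp_pos _
  refine le_of_mul_le_mul_left ?_ hpos
  calc e T * ∑ k, F k T ^ 2 ≤ e s * ∑ k, F k s ^ 2 := by linarith
    _ = e T * (Real.exp (-2 * γ * (T - s)) * ∑ k, F k s ^ 2) := by rw [← hexp]; ring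

/-! ### Convergence of the Dyson series -/

/-- A time-dependent generator that acts on continuous curves with locally integrable result and
whose entrywise sup norm is dominated by a locally integrable function `g`. -/
structure IsDominated {d : ℕ} (𝓛 : ℝ → Module.End ℂ (Matrix (Fin d) (Fin d) ℂ)) (g : ℝ → ℝ) :
    Prop where
  locallyIntegrable : LocallyIntegrable g volume
  nonneg : ∀ τ, 0 ≤ g τ
  norm_apply_le : ∀ τ X (N : ℝ), (∀ i j, ‖X i j‖ ≤ N) → ∀ i j, ‖𝓛 τ X i j‖ ≤ g τ * N
  intervalIntegrable : ∀ a b (Φ : ℝ → Matrix (Fin d) (Fin d) ℂ),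
    (∀ i j, ContinuousOn (fun τ => Φ τ i j) (Set.uIcc a b)) →
      ∀ i j, IntervalIntegrable (fun τ => 𝓛 τ (Φ τ) i j) volume a b

theorem exists_norm_apply_le {d : ℕ} (𝓓 : Module.End ℂ (Matrix (Fin d) (Fin d) ℂ)) :
    ∃ C : ℝ, 0 ≤ C ∧ ∀ X (N : ℝ), (∀ i j, ‖X i j‖ ≤ N) → ∀ i j, ‖𝓓 X i j‖ ≤ C * N := by
  refine ⟨∑ i, ∑ j, ∑ a, ∑ b, ‖𝓓 (Matrix.single a b 1) i j‖, by positivity, fun X N hX i j => ?_⟩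
  have hN : 0 ≤ N := (norm_nonneg _).trans (hX i j)
  have hexp : 𝓓 X i j = ∑ a, ∑ b, X a b * 𝓓 (Matrix.single a b 1) i j := by
    have h : X = ∑ a, ∑ b, X a b • Matrix.single a b (1 : ℂ) := by
      simpa using Matrix.matrix_eq_sum_single X
    conv_lhs => rw [h]
    simp only [map_sum, map_smul, Matrix.sum_apply, Matrix.smul_apply, smul_eq_mul]
  calc ‖𝓓 X i j‖ ≤ ∑ a, ∑ b, ‖𝓓 (Matrix.single a b 1) i j‖ * N := by
        rw [hexp]
        refine norm_sum_le_of_le _ fun a _ => norm_sum_le_of_le _ fun b _ => ?_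
        rw [norm_mul, mul_comm]
        gcongr
        exact hX a b
    _ = (∑ a, ∑ b, ‖𝓓 (Matrix.single a b 1) i j‖) * N := by simp only [Finset.sum_mul]
    _ ≤ _ := by
      refine mul_le_mul_of_nonneg_right ?_ hN
      refine (Finset.single_le_sum (f := fun j => ∑ a, ∑ b, ‖𝓓 (Matrix.single a b 1) i j‖)
        (fun j _ => by positivity) (Finset.mem_univ j)).trans ?_
      exact Finset.single_le_sum (f := fun i => ∑ j, ∑ a, ∑ b, ‖𝓓 (Matrix.single a b 1) i j‖)
        (fun i _ => by positivity) (Finset.mem_univ i)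

theorem isDominated_lindbladian {d : ℕ} {H : ℝ → Matrix (Fin d) (Fin d) ℂ}
    (hH : ∀ i j, LocallyIntegrable (fun t => H t i j) volume)
    (𝓓 : Module.End ℂ (Matrix (Fin d) (Fin d) ℂ)) :
    ∃ g, IsDominated (fun t => hamiltonianPart (H t) + 𝓓) g := by
  obtain ⟨C, hC0, hC⟩ := exists_norm_apply_le 𝓓
  have happ : ∀ (τ : ℝ) (X : Matrix (Fin d) (Fin d) ℂ) i j, (hamiltonianPart (H τ) + 𝓓) X i j =
      -Complex.I * (∑ k, H τ i k * X k j - ∑ k, X i k * H τ k j) + 𝓓 X i j := fun τ X i j => rfl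
  -- One copy of the entry sum for each of `H * X` and `X * H`, and `C` for the dissipator.
  refine ⟨fun τ => (∑ a, ∑ b, ‖H τ a b‖) + (∑ a, ∑ b, ‖H τ a b‖) + C, ?_, ?_, ?_, ?_⟩
  · have h : LocallyIntegrable (fun τ => ∑ a, ∑ b, ‖H τ a b‖) volume := by
      refine locallyIntegrable_finsetSum _ fun a _ => locallyIntegrable_finsetSum _ fun b _ => ?_
      intro x
      obtain ⟨u, hu, h⟩ := hH a b x
      exact ⟨u, hu, h.norm⟩
    exact (h.add h).add (locallyIntegrable_const C)
  · intro τ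
    positivity
  · intro τ X N hX i j
    have hN : 0 ≤ N := (norm_nonneg _).trans (hX i j)
    rw [happ, add_mul, add_mul]
    have h1 : ‖∑ k, H τ i k * X k j‖ ≤ (∑ a, ∑ b, ‖H τ a b‖) * N := by
      calc ‖∑ k, H τ i k * X k j‖ ≤ ∑ k, ‖H τ i k‖ * N := norm_sum_le_of_le _ fun k _ => by
            rw [norm_mul]
            gcongr
            exact hX k j
        _ = (∑ k, ‖H τ i k‖) * N := by rw [Finset.sum_mul]
        _ ≤ _ := by
          refine mul_le_mul_of_nonneg_right ?_ hN
          exact Finset.single_le_sum (f := fun a => ∑ b, ‖H τ a b‖)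
            (fun a _ => Finset.sum_nonneg fun b _ => norm_nonneg _) (Finset.mem_univ i)
    have h2 : ‖∑ k, X i k * H τ k j‖ ≤ (∑ a, ∑ b, ‖H τ a b‖) * N := by
      calc ‖∑ k, X i k * H τ k j‖ ≤ ∑ k, ‖H τ k j‖ * N := norm_sum_le_of_le _ fun k _ => by
            rw [norm_mul, mul_comm]
            gcongr
            exact hX i k
        _ = (∑ k, ‖H τ k j‖) * N := by rw [Finset.sum_mul]
        _ ≤ _ := by
          gcongr with k
          exact Finset.single_le_sum (f := fun b => ‖H τ k b‖)
            (fun b _ => norm_nonneg _) (Finset.mem_univ j)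
    refine (norm_add_le _ _).trans (add_le_add ?_ (hC X N hX i j))
    rw [norm_mul, norm_neg, Complex.norm_I, one_mul]
    exact (norm_sub_le _ _).trans (add_le_add h1 h2)
  · intro a b Φ hΦ i j
    simp only [happ]
    have hI : ∀ k l, IntervalIntegrable (fun τ => H τ k l) volume a b := fun k l =>
      intervalIntegrable_iff.mpr <|
        ((hH k l).integrableOn_isCompact isCompact_uIcc).mono_set Set.uIoc_subset_uIcc
    have hΦ' : ContinuousOn Φ (Set.uIcc a b) :=
      continuousOn_pi.mpr fun i => continuousOn_pi.mpr fun j => hΦ i j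
    have h𝓓 : Continuous 𝓓 := LinearMap.continuous_of_finiteDimensional 𝓓
    refine IntervalIntegrable.add (IntervalIntegrable.const_mul (IntervalIntegrable.sub ?_ ?_) _) ?_
    · simpa only [Finset.sum_fn] using
        IntervalIntegrable.sum Finset.univ fun k _ => (hI i k).mul_continuousOn (hΦ k j)
    · simpa only [Finset.sum_fn] using
        IntervalIntegrable.sum Finset.univ fun k _ => (hI k j).continuousOn_mul (hΦ i k)
    · refine ContinuousOn.intervalIntegrable ?_
      exact ((continuous_apply_apply i j).comp h𝓓).comp_continuousOn hΦ'

variable {d : ℕ} {𝓛 : ℝ → Module.End ℂ (Matrix (Fin d) (Fin d) ℂ)} {g : ℝ → ℝ}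

theorem IsDominated.intervalIntegrable_dominating (h𝓛 : IsDominated 𝓛 g) (a b : ℝ) :
    IntervalIntegrable g volume a b :=
  intervalIntegrable_iff.mpr <|
    (h𝓛.locallyIntegrable.integrableOn_isCompact isCompact_uIcc).mono_set Set.uIoc_subset_uIcc

theorem IsDominated.continuous_dysonTerm (h𝓛 : IsDominated 𝓛 g) (s : ℝ)
    (X : Matrix (Fin d) (Fin d) ℂ) (n : ℕ) (i j : Fin d) :
    Continuous fun t => dysonTerm 𝓛 s X n t i j := by
  induction n generalizing i j with
  | zero => exact continuous_const
  | succ n ih =>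
    exact intervalIntegral.continuous_primitive (fun a b =>
      h𝓛.intervalIntegrable a b _ (fun i j => (ih i j).continuousOn) i j) s

/-- The factorial is the gain from integrating over ordered times; `integral_mul_pow_div_factorial`
carries the induction. -/
theorem IsDominated.norm_dysonTerm_le (h𝓛 : IsDominated 𝓛 g) {s : ℝ}
    {X : Matrix (Fin d) (Fin d) ℂ} {N : ℝ} (hX : ∀ i j, ‖X i j‖ ≤ N) (n : ℕ) {t : ℝ}
    (hst : s ≤ t) (i j : Fin d) :
    ‖dysonTerm 𝓛 s X n t i j‖ ≤ N * ((∫ u in s..t, g u) ^ n / (n.factorial : ℝ)) := by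
  induction n generalizing t i j with
  | zero => simpa [dysonTerm] using hX i j
  | succ n ih =>
    have hg := h𝓛.intervalIntegrable_dominating s t
    calc ‖dysonTerm 𝓛 s X (n + 1) t i j‖
        ≤ ∫ τ in s..t, N * (g τ * ((∫ u in s..τ, g u) ^ n / (n.factorial : ℝ))) := by
          refine intervalIntegral.norm_integral_le_of_norm_le hst (ae_of_all _ fun τ hτ => ?_) ?_
          · have := h𝓛.norm_apply_le τ _ _ (fun i j => ih hτ.1.le i j) i j
            calc _ ≤ _ := this
              _ = _ := by ring
          · refine (hg.mul_continuousOn (ContinuousOn.div_const (ContinuousOn.pow ?_ n) _)).const_mul N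
            exact (intervalIntegral.continuous_primitive
              h𝓛.intervalIntegrable_dominating s).continuousOn
      _ = _ := by rw [intervalIntegral.integral_const_mul, integral_mul_pow_div_factorial hg n]

/-- Makes the bound uniform in `t`, as needed for uniform convergence and for dominated convergence.
-/
theorem IsDominated.norm_dysonTerm_le_of_mem_Icc (h𝓛 : IsDominated 𝓛 g) {s T : ℝ}
    {X : Matrix (Fin d) (Fin d) ℂ} {N : ℝ} (hX : ∀ i j, ‖X i j‖ ≤ N) (n : ℕ) {t : ℝ}
    (ht : t ∈ Set.Icc s T) (i j : Fin d) :
    ‖dysonTerm 𝓛 s X n t i j‖ ≤ N * ((∫ u in s..T, g u) ^ n / (n.factorial : ℝ)) := by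
  have hN : 0 ≤ N := (norm_nonneg _).trans (hX i j)
  have h0 : 0 ≤ ∫ u in s..t, g u := intervalIntegral.integral_nonneg_of_forall ht.1 h𝓛.nonneg
  have h1 : ∫ u in s..t, g u ≤ ∫ u in s..T, g u :=
    intervalIntegral.integral_mono_interval le_rfl ht.1 ht.2 (ae_of_all _ h𝓛.nonneg)
      (h𝓛.intervalIntegrable_dominating s T)
  refine (h𝓛.norm_dysonTerm_le hX n ht.1 i j).trans ?_
  gcongr

theorem exists_norm_entry_le (X : Matrix (Fin d) (Fin d) ℂ) : ∃ N : ℝ, ∀ i j, ‖X i j‖ ≤ N := by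
  obtain ⟨N, hN⟩ := (Set.finite_range fun p : Fin d × Fin d => ‖X p.1 p.2‖).bddAbove
  exact ⟨N, fun i j => hN ⟨(i, j), rfl⟩⟩

theorem IsDominated.hasSum_dysonTerm (h𝓛 : IsDominated 𝓛 g) (X : Matrix (Fin d) (Fin d) ℂ)
    {s t : ℝ} (hst : s ≤ t) : HasSum (fun n => dysonTerm 𝓛 s X n t) (evolution 𝓛 t s X) := by
  obtain ⟨N, hX⟩ := exists_norm_entry_le X
  refine Summable.hasSum (Pi.summable.mpr fun i => Pi.summable.mpr fun j => ?_)
  exact Summable.of_norm_bounded ((Real.summable_pow_div_factorial _).mul_left N)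
    fun n => h𝓛.norm_dysonTerm_le hX n hst i j

theorem IsDominated.hasSum_dysonTerm_apply (h𝓛 : IsDominated 𝓛 g)
    (X : Matrix (Fin d) (Fin d) ℂ) {s t : ℝ} (hst : s ≤ t) (i j : Fin d) :
    HasSum (fun n => dysonTerm 𝓛 s X n t i j) (evolution 𝓛 t s X i j) :=
  Pi.hasSum.mp (Pi.hasSum.mp (h𝓛.hasSum_dysonTerm X hst) i) j

theorem IsDominated.continuousOn_evolution (h𝓛 : IsDominated 𝓛 g)
    (X : Matrix (Fin d) (Fin d) ℂ) (s T : ℝ) (i j : Fin d) :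
    ContinuousOn (fun t => evolution 𝓛 t s X i j) (Set.Icc s T) := by
  obtain ⟨N, hX⟩ := exists_norm_entry_le X
  refine ContinuousOn.congr (f := fun t => ∑' n, dysonTerm 𝓛 s X n t i j) ?_
    fun t ht => (h𝓛.hasSum_dysonTerm_apply X ht.1 i j).tsum_eq.symm
  exact continuousOn_tsum (fun n => (h𝓛.continuous_dysonTerm s X n i j).continuousOn)
    ((Real.summable_pow_div_factorial (∫ u in s..T, g u)).mul_left N)
    fun n t ht => h𝓛.norm_dysonTerm_le_of_mem_Icc hX n ht i j

theorem IsDominated.intervalIntegrable_evolution (h𝓛 : IsDominated 𝓛 g)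
    (X : Matrix (Fin d) (Fin d) ℂ) {s T : ℝ} (hsT : s ≤ T) (i j : Fin d) :
    IntervalIntegrable (fun τ => 𝓛 τ (evolution 𝓛 τ s X) i j) volume s T :=
  h𝓛.intervalIntegrable s T _ (fun i j => by
    rw [Set.uIcc_of_le hsT]
    exact h𝓛.continuousOn_evolution X s T i j) i j

/-- The Dyson series solves the integral form of `Ẋ = 𝓛_t X`. -/
theorem IsDominated.evolution_eq_add_integral (h𝓛 : IsDominated 𝓛 g)
    (X : Matrix (Fin d) (Fin d) ℂ) {s t : ℝ} (hst : s ≤ t) (i j : Fin d) :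
    evolution 𝓛 t s X i j = X i j + ∫ τ in s..t, 𝓛 τ (evolution 𝓛 τ s X) i j := by
  obtain ⟨N, hX⟩ := exists_norm_entry_le X
  have hsum := (Real.summable_pow_div_factorial (∫ u in s..t, g u)).mul_left N
  have hg := h𝓛.intervalIntegrable_dominating s t
  have hint : HasSum (fun n => ∫ τ in s..t, 𝓛 τ (dysonTerm 𝓛 s X n τ) i j)
      (∫ τ in s..t, 𝓛 τ (evolution 𝓛 τ s X) i j) := by
    refine intervalIntegral.hasSum_integral_of_dominated_convergence
      (fun n τ => g τ * (N * ((∫ u in s..t, g u) ^ n / (n.factorial : ℝ)))) ?_ ?_ ?_ ?_ ?_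
    · exact fun n => (h𝓛.intervalIntegrable s t _ (fun i j =>
        (h𝓛.continuous_dysonTerm s X n i j).continuousOn) i j).aestronglyMeasurable_restrict_uIoc
    · refine fun n => ae_of_all _ fun τ hτ => ?_
      rw [Set.uIoc_of_le hst] at hτ
      exact h𝓛.norm_apply_le τ _ _ (fun i j =>
        h𝓛.norm_dysonTerm_le_of_mem_Icc hX n (Set.Ioc_subset_Icc_self hτ) i j) i j
    · exact ae_of_all _ fun τ _ => hsum.mul_left (g τ)
    · simp_rw [tsum_mul_left]
      exact hg.mul_const _
    · refine ae_of_all _ fun τ hτ => ?_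
      rw [Set.uIoc_of_le hst] at hτ
      have hc : Continuous (𝓛 τ) := LinearMap.continuous_of_finiteDimensional _
      exact Pi.hasSum.mp (Pi.hasSum.mp ((h𝓛.hasSum_dysonTerm X hτ.1.le).map (𝓛 τ) hc) i) j
  have h0 : HasSum (fun n => dysonTerm 𝓛 s X n t i j)
      (X i j + ∫ τ in s..t, 𝓛 τ (evolution 𝓛 τ s X) i j) :=
    -- The zeroth Dyson term is `X`, and term `n + 1` is by definition the integral summed in
    -- `hint`.
    HasSum.zero_add (f := fun n => dysonTerm 𝓛 s X n t i j) hint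
  exact (h𝓛.hasSum_dysonTerm_apply X hst i j).unique h0

/-! ### Exponential contraction -/

theorem isClosed_setOf_isTracelessHermitian :
    IsClosed {X : Matrix (Fin 2) (Fin 2) ℂ | IsTracelessHermitian X} := by
  refine IsClosed.inter (isClosed_eq ?_ continuous_id) (isClosed_eq ?_ continuous_const)
  · exact continuous_id.matrix_conjTranspose
  · exact continuous_id.matrix_trace

theorem IsTracelessHermitian.dysonTerm {𝓛 : ℝ → Module.End ℂ (Matrix (Fin 2) (Fin 2) ℂ)}
    (h𝓛 : ∀ τ X, IsTracelessHermitian X → IsTracelessHermitian (𝓛 τ X))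
    {X : Matrix (Fin 2) (Fin 2) ℂ} (hX : IsTracelessHermitian X) (s : ℝ) (n : ℕ) (t : ℝ) :
    IsTracelessHermitian (dysonTerm 𝓛 s X n t) := by
  induction n generalizing t with
  | zero => exact hX
  | succ n ih =>
    have h := fun τ => isTracelessHermitian_iff.mp (h𝓛 τ _ (ih τ))
    refine isTracelessHermitian_iff.mpr ⟨?_, ?_, ?_⟩
    · have h0 : ∀ τ, starRingEnd ℂ (𝓛 τ (Lindblad.dysonTerm 𝓛 s X n τ) 0 0) =
          𝓛 τ (Lindblad.dysonTerm 𝓛 s X n τ) 0 0 := fun τ => Complex.conj_eq_iff_im.mpr (h τ).1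
      rw [← Complex.conj_eq_iff_im]
      simp only [Lindblad.dysonTerm, Matrix.of_apply, ← intervalIntegral.intervalIntegral_conj, h0]
    · simp only [Lindblad.dysonTerm, Matrix.of_apply, (h _).2.1, intervalIntegral.integral_neg]
    · simp only [Lindblad.dysonTerm, Matrix.of_apply, ← intervalIntegral.intervalIntegral_conj, (h _).2.2]

theorem IsTracelessHermitian.evolution {𝓛 : ℝ → Module.End ℂ (Matrix (Fin 2) (Fin 2) ℂ)}
    (hdom : IsDominated 𝓛 g) (h𝓛 : ∀ τ X, IsTracelessHermitian X → IsTracelessHermitian (𝓛 τ X))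
    {X : Matrix (Fin 2) (Fin 2) ℂ} (hX : IsTracelessHermitian X) {s t : ℝ} (hst : s ≤ t) :
    IsTracelessHermitian (evolution 𝓛 t s X) :=
  isClosed_setOf_isTracelessHermitian.mem_of_tendsto (hdom.hasSum_dysonTerm X hst)
    (Filter.Eventually.of_forall fun _ => IsTracelessHermitian.sum fun n _ =>
      hX.dysonTerm h𝓛 s n t)

/-- The evolution stays traceless Hermitian and solves the integral equation, so its Bloch vector
obeys the Grönwall inequality. -/
theorem isExpContractive_of_dissipative {𝓛 : ℝ → Module.End ℂ (Matrix (Fin 2) (Fin 2) ℂ)}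
    (hdom : IsDominated 𝓛 g) (h𝓛 : ∀ τ X, IsTracelessHermitian X → IsTracelessHermitian (𝓛 τ X))
    {γ : ℝ} (hγ : 0 < γ) (hd : ∀ τ X, IsTracelessHermitian X →
      ∑ i, blochCoord X i * blochCoord (𝓛 τ X) i ≤ -γ * ∑ i, blochCoord X i ^ 2) :
    IsExpContractive 𝓛 := by
  refine ⟨1, γ, one_pos, hγ, fun ρ σ hρ hσ s t _ hst => ?_⟩
  have hX := hρ.sub_isTracelessHermitian hσ
  set X := ρ - σ
  have hE : ∀ τ, s ≤ τ → IsTracelessHermitian (evolution 𝓛 τ s X) :=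
    fun τ hτ => hX.evolution hdom h𝓛 hτ
  have hint := hdom.intervalIntegrable_evolution X hst
  have hs : evolution 𝓛 s s X = X := by
    ext i j
    simpa using hdom.evolution_eq_add_integral X le_rfl i j
  have hre : ∀ i j, ∀ τ ∈ Set.Icc s t, (evolution 𝓛 τ s X i j).re =
      (evolution 𝓛 s s X i j).re + ∫ u in s..τ, (𝓛 u (evolution 𝓛 u s X) i j).re := by
    intro i j τ hτ
    rw [hdom.evolution_eq_add_integral X hτ.1, hs, Complex.add_re]
    exact congrArg _ (intervalIntegral.intervalIntegral_re (hdom.intervalIntegrable_evolution X hτ.1 i j)).symm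
  have him : ∀ i j, ∀ τ ∈ Set.Icc s t, (evolution 𝓛 τ s X i j).im =
      (evolution 𝓛 s s X i j).im + ∫ u in s..τ, (𝓛 u (evolution 𝓛 u s X) i j).im := by
    intro i j τ hτ
    rw [hdom.evolution_eq_add_integral X hτ.1, hs, Complex.add_im]
    exact congrArg _ (intervalIntegral.intervalIntegral_im (hdom.intervalIntegrable_evolution X hτ.1 i j)).symm
  have hre' : ∀ i j, IntervalIntegrable
      (fun u => (𝓛 u (evolution 𝓛 u s X) i j).re) volume s t := fun i j =>
    ⟨(hint i j).1.re, (hint i j).2.re⟩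
  have him' : ∀ i j, IntervalIntegrable
      (fun u => (𝓛 u (evolution 𝓛 u s X) i j).im) volume s t := fun i j =>
    ⟨(hint i j).1.im, (hint i j).2.im⟩
  have key := sum_sq_le_exp_mul_of_integral_eq (ι := Fin 3) (γ := γ)
    (F := fun k τ => blochCoord (evolution 𝓛 τ s X) k)
    (f := fun k τ => blochCoord (𝓛 τ (evolution 𝓛 τ s X)) k) hst
    (by
      intro k
      fin_cases k
      · exact hre' 0 0
      · exact hre' 0 1
      · exact him' 0 1)
    (by
      intro k
      fin_cases k
      · exact hre 0 0
      · exact hre 0 1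
      · exact him 0 1)
    (fun τ hτ => hd τ _ (hE τ hτ.1))
  rw [hs] at key
  rw [(hE t hst).traceNorm_eq, hX.traceNorm_eq, one_mul, abs_of_nonneg (sub_nonneg.mpr hst)]
  have hsqrt := Real.sqrt_le_sqrt key
  -- Grönwall bounds the squared length; the square root halves the exponent.
  have hexp : Real.exp (-2 * γ * (t - s)) = Real.exp (-γ * (t - s)) ^ 2 := by
    rw [← Real.exp_nat_mul]
    congr 1
    push_cast
    ring
  rw [Real.sqrt_mul (Real.exp_pos _).le, hexp, Real.sqrt_sq (Real.exp_pos _).le] at hsqrt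
  linarith

/-- The Hamiltonian drops out of the dissipation estimate, so the rate of the dissipator alone
serves for every `H`. -/
theorem isHamiltonianIndependentlyContractive_dissipator {m : ℕ}
    {L : Fin m → Matrix (Fin 2) (Fin 2) ℂ}
    (h : (∃ j, ¬ IsStarNormal (L j)) ∨ ∃ j k, ¬ Commute (L j) (L k)) :
    IsHamiltonianIndependentlyContractive (dissipator L) := by
  intro H hH hloc
  obtain ⟨g, hdom⟩ := isDominated_lindbladian hloc (dissipator L)
  obtain ⟨γ, hγ, hd⟩ := exists_dissipation_rate h
  refine isExpContractive_of_dissipative hdom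
    (fun τ X hX => (hX.hamiltonianPart (hH τ)).add (hX.dissipator L)) hγ fun τ X hX => ?_
  have hadd : ∀ i, blochCoord ((hamiltonianPart (H τ) + dissipator L) X) i =
      blochCoord (hamiltonianPart (H τ) X) i + blochCoord (dissipator L X) i := by
    intro i
    fin_cases i <;> simp [blochCoord]
  simp only [hadd, mul_add, Finset.sum_add_distrib, blochCoord_dot_hamiltonianPart hX (hH τ),
    zero_add]
  exact hd X hX

theorem IsHamiltonianIndependentlyContractive.isExpContractive
    {𝓓 : Module.End ℂ (Matrix (Fin d) (Fin d) ℂ)}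
    (h : IsHamiltonianIndependentlyContractive 𝓓) : IsExpContractive fun _ => 𝓓 := by
  have h0 := h (fun _ => 0) (fun _ => Matrix.isHermitian_zero) fun i j => locallyIntegrable_const 0
  have hz : hamiltonianPart (0 : Matrix (Fin d) (Fin d) ℂ) = 0 := by
    ext1 X
    simp [hamiltonianPart]
  simpa only [hz, zero_add] using h0

end Lindblad

theorem mainTheorem7 {m : ℕ} (L : Fin m → Matrix (Fin 2) (Fin 2) ℂ) :
    List.TFAE [
      Lindblad.IsHamiltonianIndependentlyContractive (Lindblad.dissipator L),
      Lindblad.IsExpContractive (fun _ => Lindblad.dissipator L),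
      Algebra.adjoin ℂ (Set.range L ∪ Set.range (fun j => (L j)ᴴ)) = ⊤,
      (∃ j, ¬ IsStarNormal (L j)) ∨ ∃ j k, ¬ Commute (L j) (L k)] := by
  tfae_have 1 → 2 := fun h => h.isExpContractive
  tfae_have 2 → 4 := fun h => by
    by_contra! hc
    exact Lindblad.not_isExpContractive_of_isStarNormal hc.1 hc.2 h
  tfae_have 4 → 1 := Lindblad.isHamiltonianIndependentlyContractive_dissipator
  tfae_have 3 ↔ 4 := Lindblad.adjoin_eq_top_iff L
  tfae_finish
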